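/- All rings are commutative with identity. Let $S$ be a ring, let $K$ be an $S$-module, and let $C$ be a multiplicatively closed set of nonzerodivisors of $S$ that are also nonzerodivisors on $K$. A subring $R$ of $S$ is *twisted by $K$ along $C$* if there is a $C$-linear derivation $D : S_C \to K_C$ such that (a) $R = S \cap D^{-1}(K)$, (b) $D(S_C)$ generates $K_C$ as an $S_C$-module, and (c) $S \subseteq \operatorname{Ker} D + cS$ for all $c \in C$. An $S$-module is *$C$-torsion-free* if no nonzero element of it is annihilated by an element of $C$. **Theorem 5.7.** Let $(S,N)$ be a two-dimensional local Noetherian UFD with quotient field $F$. Suppose that $S$ is birationally dominated by a DVR $V$ (that is, $S \subseteq V \subseteq F$, $V$ has quotient field $F$, and the maximal ideal of $V$ contracts to $N$), that $V$ has the same residue field as $S$ (that is, the canonical map from $S/N$ to the residue field of $V$ is an isomorphism), and that there is $t \in N$ such that $tV$ is the maximal ideal of $V$. Put $C = \{t^i : i > 0\}$, and let $\widehat{V}$ be the completion of $V$. Let $K'$ be a finitely generated free $\widehat{V}$-module, and let $K$ be an $S$-submodule of $K'$ such that $K'/K$ is a $C$-torsion-free $S$-module. If $R$ is a subring of $S$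 that is twisted by $K$ along $C$, then $R$ is a two-dimensional local Noetherian ring, and for every height $1$ prime ideal $P$ of $R$ there is a height $1$ prime ideal $Q$ of $S$ such that $R_P = S_Q$ as subrings of $F$. -/

import Mathlib

/-- The `S`-module `L` is `C`-torsion-free: the only element of `L` that is killed by an element
of `C` is `0` (that is, the elements of `C` are nonzerodivisors on `L`). -/
def IsTorsionFreeAlong {S : Type*} [CommRing S] (C : Submonoid S)
    (L : Type*) [AddCommGroup L] [Module S L] : Prop :=
  ∀ c ∈ C, ∀ x : L, c • x = 0 → x = 0

/-- `D` twists the subring `R` of `S` by the `S`-module `K` along `C`. Here `C` consists of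
nonzerodivisors of `S` that are nonzerodivisors on `K`, and `D : S_C → K_C` is an (additive)
derivation from the localization `S_C = Localization C` to the localization
`K_C = LocalizedModule C K`. The set `S ∩ D⁻¹(K)` is formed along the canonical maps `S → S_C` and
`K → K_C`, which are injective. -/
structure Twists {S : Type*} [CommRing S] (C : Submonoid S)
    (K : Type*) [AddCommGroup K] [Module S K] (R : Subring S)
    (D : Derivation ℤ (Localization C) (LocalizedModule C K)) : Prop where
  nonZeroDivisors_ring : C ≤ nonZeroDivisors S
  nonZeroDivisors_module : IsTorsionFreeAlong C K
  /-- `D` is `C`-linear. -/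
  map_smul : ∀ c ∈ C, ∀ x : Localization C, D (c • x) = c • D x
  /-- `R = S ∩ D⁻¹(K)`. -/
  mem_iff : ∀ s : S, s ∈ R ↔
    D (algebraMap S (Localization C) s) ∈ LinearMap.range (LocalizedModule.mkLinearMap C K)
  /-- `D(S_C)` generates `K_C` as an `S_C`-module. -/
  span_range : Submodule.span (Localization C) (Set.range D) = ⊤
  /-- `S ⊆ Ker D + cS` for all `c ∈ C`. -/
  ker_add : ∀ c ∈ C, ∀ s : S, ∃ x : Localization C, D x = 0 ∧
    ∃ b : S, algebraMap S (Localization C) s = x + algebraMap S (Localization C) (c * b)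

/-- The subring `R` of `S` is twisted by the `S`-module `K` along `C`. -/
def IsTwistedBy {S : Type*} [CommRing S] (C : Submonoid S)
    (K : Type*) [AddCommGroup K] [Module S K] (R : Subring S) : Prop :=
  ∃ D : Derivation ℤ (Localization C) (LocalizedModule C K), Twists C K R D

/-- For a domain `A` inside a field `F` and a prime ideal `P` of `A`, the localization `A_P` as a
subset of `F`: all fractions `a / b` with `a, b ∈ A` and `b ∉ P`. -/
def localizationIn {A : Type*} [CommRing A] (F : Type*) [Field F] [Algebra A F]
    (P : Ideal A) [P.IsPrime] : Set F :=
  {x | ∃ a b : A, b ∉ P ∧ x = algebraMap A F a / algebraMap A F b}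

/-! Restrict the derivation to `S` and let `E₀` be the image of `K` in `K_C`. The splittings `s = a
+ t ^ n * b` with `d a = 0` make `S` integral over `R`. Each `p ∈ N` is a multiple of `t` in `V`,
and `K` is saturated in `K'`, so `N E₀ ⊆ t E₀`. Hence powers of a nonunit of `R` push `S` into `R`
(`exists_pow_mul_mem`), so the spectra agree, and so do the localizations away from the maximal
ideals. By Cohen's theorem it remains to see that nonzero primes of `R` are finitely generated. For
those containing `t`, filter `R ⊇ R ∩ tS ⊇ tR`: the first quotient embeds in `S / tS`, the second,
through `d`, in `E₀ / tE₀ ⊆ K' / tK'`, which is finite over `S` because the completion of `V` is `S`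
plus its multiples of `t` (`fg_of_t_mem`). A prime without `t` is contracted from a principal prime
`qS` and is isomorphic to an ideal containing a power of `t` (`fg_comap_span_singleton`). -/

/-- A derivation `d : S → E`, a submodule `E₀` of `E` and an element `t` of `S` that present the
subring `R = d⁻¹(E₀)` of `S` as a twisted subring along the powers of `t`. -/
structure TwistData {S E : Type*} [CommRing S] [AddCommGroup E] [Module S E]
    (d : Derivation ℤ S E) (E₀ : Submodule S E) (t : S) (R : Subring S) : Prop where
  mem_iff : ∀ s, s ∈ R ↔ d s ∈ E₀
  map_t : d t = 0
  smul_cancel : ∀ x : E, t • x = 0 → x = 0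
  exists_pow_smul_mem : ∀ x : E, ∃ n : ℕ, t ^ n • x ∈ E₀
  exists_eq_add : ∀ (n : ℕ) (s : S), ∃ a b : S, d a = 0 ∧ s = a + t ^ n * b

/-! ### Integrality of `S` over `R`, and conduction of `S` into `R`. -/

namespace TwistData

variable {S E : Type*} [CommRing S] [AddCommGroup E] [Module S E]
  {d : Derivation ℤ S E} {E₀ : Submodule S E} {t : S} {R : Subring S}

section
variable (h : TwistData d E₀ t R)
include h

theorem map_pow (n : ℕ) : d (t ^ n) = 0 := by
  rw [Derivation.leibniz_pow, h.map_t]; simp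

theorem map_pow_mul (n : ℕ) (s : S) : d (t ^ n * s) = t ^ n • d s := by
  rw [Derivation.leibniz, h.map_pow]; simp

theorem map_t_mul (s : S) : d (t * s) = t • d s := by
  simpa using h.map_pow_mul 1 s

theorem t_mem : t ∈ R := by rw [h.mem_iff, h.map_t]; exact zero_mem _

theorem smul_left_cancel {x y : E} (hxy : t • x = t • y) : x = y :=
  sub_eq_zero.1 (h.smul_cancel _ (by rw [smul_sub, hxy, sub_self]))

theorem pow_smul_left_cancel {x y : E} {n : ℕ} (hxy : t ^ n • x = t ^ n • y) : x = y := by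
  induction n with
  | zero => simpa using hxy
  | succ n ih =>
    refine ih (h.smul_left_cancel ?_)
    rwa [smul_smul, smul_smul, ← pow_succ']

theorem mem_of_map_eq_zero {a : S} (ha : d a = 0) : a ∈ R := by
  rw [h.mem_iff, ha]; exact zero_mem _

theorem exists_sub_mem (s : S) : ∃ a : R, ∃ b : S, s = a + t * b := by
  obtain ⟨a, b, ha, hs⟩ := h.exists_eq_add 1 s
  exact ⟨⟨a, h.mem_of_map_eq_zero ha⟩, b, by simpa using hs⟩

theorem isIntegral : Algebra.IsIntegral R S := by
  refine ⟨fun s ↦ ?_⟩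
  obtain ⟨n, hn⟩ := h.exists_pow_smul_mem (d s)
  obtain ⟨a, b, ha, hs⟩ := h.exists_eq_add n s
  have hb : t ^ n • d b = d s := by
    rw [hs, map_add, ha, zero_add, h.map_pow_mul]
  -- Since `d (t ^ n * b) = d s`, the square has derivative `2b • t ^ n • d s`, and `t ^ n` clears
  -- the denominator of `d s`.
  have hsq : (t ^ n * b) ^ 2 ∈ R := by
    rw [h.mem_iff, Derivation.leibniz_pow, h.map_pow_mul, hb]
    have : 2 • (t ^ n * b) ^ (2 - 1) • d s = (2 * b) • t ^ n • d s := by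
      rw [← Nat.cast_smul_eq_nsmul S, smul_smul, smul_smul]; congr 1; push_cast; ring
    rw [this]
    exact E₀.smul_mem _ hn
  have h1 : IsIntegral R (t ^ n * b) :=
    IsIntegral.of_pow (n := 2) two_pos
      (isIntegral_algebraMap (R := R) (A := S) (x := ⟨_, hsq⟩))
  have h2 : IsIntegral R a :=
    isIntegral_algebraMap (R := R) (A := S) (x := ⟨a, h.mem_of_map_eq_zero ha⟩)
  rw [hs]
  exact h2.add h1

theorem isLocalRing [IsLocalRing S] : IsLocalRing R := by
  have := h.isIntegral
  exact RingHom.domain_isLocalRing (algebraMap R S)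

/-- Powers of a nonunit of `R` conduct `S` into `R`. -/
theorem exists_pow_mul_mem {p : S} (hpR : p ∈ R)
    (hp : ∀ x ∈ E₀, ∃ y ∈ E₀, p • x = t • y) (s : S) : ∃ n : ℕ, p ^ n * s ∈ R := by
  -- Each factor `p` supplies a factor `t`, so `p ^ n` clears the denominator `t ^ n`.
  have key : ∀ (n : ℕ) (x : E), t ^ n • x ∈ E₀ → p ^ n • x ∈ E₀ := by
    intro n
    induction n with
    | zero => intro x hx; simpa using hx
    | succ n ih =>
      intro x hx
      have h1 : p ^ n • t • x ∈ E₀ := ih _ (by rwa [smul_smul, ← pow_succ])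
      obtain ⟨y, hy, hxy⟩ := hp _ h1
      have : p ^ (n + 1) • x = y := by
        apply h.smul_left_cancel
        rw [← hxy, smul_smul, smul_smul, smul_smul]; congr 1; ring
      rwa [this]
  obtain ⟨n, hn⟩ := h.exists_pow_smul_mem (d s)
  refine ⟨n, ?_⟩
  rw [h.mem_iff, Derivation.leibniz]
  exact add_mem (key n _ hn) (E₀.smul_mem _ ((h.mem_iff _).1 (pow_mem hpR n)))

end

end TwistData

/-! ### Finitely generated ideals of `R`. -/

/-- If every element of `S` acts on `M` as an element of the subring `R`, then `M` is Noetherian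
over `R` as soon as it is Noetherian over `S`. -/
theorem Subring.isNoetherian_of_forall_exists_smul_eq {S M : Type*} [CommRing S] [AddCommGroup M]
    [Module S M] [IsNoetherian S M] (R : Subring S)
    (hR : ∀ s : S, ∃ r : R, ∀ x : M, s • x = r • x) : IsNoetherian R M := by
  let f : Submodule R M → Submodule S M := fun W ↦
    { W with
      smul_mem' := fun s x hx ↦ by
        obtain ⟨r, hr⟩ := hR s
        rw [hr]
        exact W.smul_mem r hx }
  have hf : StrictMono f := fun W W' hW ↦ hW
  rw [isNoetherian_iff']
  exact hf.wellFoundedGT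

/-- If all ideals containing `a` are finitely generated, so are all
ideals that contain a power of `a`. -/
theorem Ideal.fg_of_pow_mem {A : Type*} [CommRing A] {a : A}
    (h : ∀ I : Ideal A, a ∈ I → I.FG) (n : ℕ) (I : Ideal A) (hI : a ^ n ∈ I) : I.FG := by
  induction n generalizing I with
  | zero =>
    rw [pow_zero] at hI
    rw [(Ideal.eq_top_iff_one I).2 hI]
    exact Ideal.fg_top A
  | succ n ih =>
    refine Submodule.fg_of_fg_map_of_fg_inf_ker (Ideal.span {a}).mkQ ?_ ?_
    · have h1 : (I ⊔ Ideal.span {a}).FG :=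
        h _ (Ideal.mem_sup_right (Ideal.mem_span_singleton_self a))
      have h2 := Submodule.FG.map (Ideal.span {a}).mkQ h1
      rwa [Submodule.map_sup, Submodule.mkQ_map_self, sup_bot_eq] at h2
    · have h1 : (Submodule.comap (LinearMap.mulLeft A a) I).FG := by
        apply ih
        simpa [pow_succ'] using hI
      have h2 := Submodule.FG.map (LinearMap.mulLeft A a) h1
      rw [Submodule.map_comap_eq, inf_comm] at h2
      have hker : LinearMap.ker (Ideal.span {a}).mkQ = LinearMap.range (LinearMap.mulLeft A a) := by
        rw [Submodule.ker_mkQ]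
        ext x
        simp [Ideal.mem_span_singleton', mul_comm]
      rw [hker]
      exact h2

namespace TwistData

variable {S E : Type*} [CommRing S] [AddCommGroup E] [Module S E]
  {d : Derivation ℤ S E} {E₀ : Submodule S E} {t : S} {R : Subring S}
variable (h : TwistData d E₀ t R)
include h

/-- The `R`-linear map `ts ↦ φ (d (ts))` on `R ∩ tS`, for an `S`-linear map `φ` on `E₀` to a module
killed by `t`. -/
def linearMapOfKer {M : Type*} [AddCommGroup M] [Module S M] (htM : ∀ x : M, t • x = 0)
    (φ : E₀ →ₗ[S] M) :
    ((Ideal.span {t}).comap (algebraMap R S)) →ₗ[R] M where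
  toFun x := φ ⟨d (x.1 : S), (h.mem_iff _).1 x.1.2⟩
  map_add' x y := by
    rw [← map_add]; congr 1; ext; simp
  map_smul' r x := by
    obtain ⟨s, hs⟩ := Ideal.mem_span_singleton'.1 (Ideal.mem_comap.1 x.2)
    have hs' : (x.1 : S) = s * t := hs.symm
    -- The extra Leibniz term `x • d r` lies in `t E₀`, as `t` divides `x` and `d r ∈ E₀`; this is
    -- why `φ` kills it.
    have : (⟨d ((r • x).1 : S), (h.mem_iff _).1 (r • x).1.2⟩ : E₀) =
        (r : S) • ⟨d (x.1 : S), (h.mem_iff _).1 x.1.2⟩ +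
          t • s • ⟨d (r : S), (h.mem_iff _).1 r.2⟩ := by
      ext
      simp [Derivation.leibniz, hs', smul_smul, mul_comm]
    rw [this, map_add, map_smul, map_smul, htM, add_zero]
    rfl

theorem isNoetherian_of_smul_eq_zero {M : Type*} [AddCommGroup M] [Module S M]
    [IsNoetherian S M] (htM : ∀ x : M, t • x = 0) : IsNoetherian R M := by
  refine R.isNoetherian_of_forall_exists_smul_eq fun s ↦ ?_
  obtain ⟨a, b, rfl⟩ := h.exists_sub_mem s
  refine ⟨a, fun x ↦ ?_⟩
  rw [add_smul, mul_smul, htM, add_zero, Subring.smul_def]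

/-- If `S / tS` and `E₀ / tE₀` are Noetherian, then the ideals of `R` that contain `t` are finitely
generated. -/
theorem fg_of_t_mem [IsNoetherianRing S] {M : Type*} [AddCommGroup M] [Module S M]
    [IsNoetherian S M] (htM : ∀ x : M, t • x = 0) (φ : E₀ →ₗ[S] M)
    (hφ : ∀ x, φ x = 0 → ∃ y ∈ E₀, (x : E) = t • y)
    (I : Ideal R) (hI : (⟨t, h.t_mem⟩ : R) ∈ I) : I.FG := by
  have hS : ∀ x : S ⧸ Ideal.span {t}, t • x = 0 := by
    intro x
    obtain ⟨x, rfl⟩ := Ideal.Quotient.mk_surjective x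
    rw [← Ideal.Quotient.mk_eq_mk, ← Submodule.Quotient.mk_smul, Submodule.Quotient.mk_eq_zero]
    exact Ideal.mul_mem_right _ _ (Ideal.mem_span_singleton_self t)
  have : IsNoetherian R (S ⧸ Ideal.span {t}) := h.isNoetherian_of_smul_eq_zero hS
  have : IsNoetherian R M := h.isNoetherian_of_smul_eq_zero htM
  let f : R →ₗ[R] S ⧸ Ideal.span {t} :=
    ((Ideal.span {t}).mkQ.restrictScalars R).comp (Algebra.linearMap R S)
  let J := (Ideal.span {t}).comap (algebraMap R S)
  have hker : LinearMap.ker f = J := by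
    ext x
    simp only [f, LinearMap.mem_ker, LinearMap.comp_apply, LinearMap.restrictScalars_apply,
      Submodule.mkQ_apply, Submodule.Quotient.mk_eq_zero]
    rfl
  refine Submodule.fg_of_fg_map_of_fg_inf_ker f (IsNoetherian.noetherian _) ?_
  rw [hker]
  let ψ := h.linearMapOfKer htM φ
  have hIJ : (Submodule.comap J.subtype I).FG := by
    refine Submodule.fg_of_fg_map_of_fg_inf_ker ψ (IsNoetherian.noetherian _) ?_
    -- The kernel of `ψ` is `tR`: if `d (t * s) = t • y` with `y ∈ E₀`, then `d s = y`, so `s ∈ R`.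
    have htJ : (⟨t, h.t_mem⟩ : R) ∈ J := Ideal.mem_span_singleton_self t
    refine ⟨{⟨⟨t, h.t_mem⟩, htJ⟩}, ?_⟩
    apply le_antisymm
    · rw [Submodule.span_le]
      simp only [Finset.coe_singleton, Set.singleton_subset_iff]
      refine ⟨hI, ?_⟩
      change φ _ = 0
      rw [← map_zero φ]
      congr 1
      ext
      exact h.map_t
    · rintro ⟨x, hxJ⟩ ⟨-, hx⟩
      obtain ⟨y, hy, hxy⟩ := hφ _ hx
      obtain ⟨s, hs⟩ := Ideal.mem_span_singleton'.1 (Ideal.mem_comap.1 hxJ)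
      have hs' : (x : S) = t * s := by rw [mul_comm]; exact hs.symm
      have hsR : s ∈ R := by
        rw [h.mem_iff]
        convert hy
        apply h.smul_left_cancel
        rw [← hxy, ← h.map_t_mul, ← hs']
      rw [Finset.coe_singleton, Submodule.mem_span_singleton]
      refine ⟨⟨s, hsR⟩, ?_⟩
      ext
      simp [hs', mul_comm]
  have h2 := Submodule.FG.map J.subtype hIJ
  rwa [Submodule.map_comap_eq, Submodule.range_subtype, inf_comm] at h2

/-- The contraction to `R` of a principal ideal `qS` not containing `t` is finitely generated. -/
theorem fg_comap_span_singleton [IsDomain S] (hfg : ∀ I : Ideal R, (⟨t, h.t_mem⟩ : R) ∈ I → I.FG)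
    (ht0 : t ≠ 0) {q : S}
    (hq : ∃ e : ℕ, ∀ x : E, q • x ∈ E₀ → t ^ e • x ∈ E₀) :
    ((Ideal.span {q}).comap (algebraMap R S)).FG := by
  obtain ⟨e, he⟩ := hq
  obtain ⟨j, hj⟩ := h.exists_pow_smul_mem (d q)
  set P := (Ideal.span {q}).comap (algebraMap R S)
  let τ : R := ⟨t, h.t_mem⟩
  let c : R := ⟨t ^ j * q, by rwa [h.mem_iff, h.map_pow_mul]⟩
  have hcP : c ∈ P := Ideal.mul_mem_left _ _ (Ideal.mem_span_singleton_self q)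
  -- For `q * s ∈ R`, the factor `t ^ (e + j)` brings `s` into `R`, and the other `t ^ j` goes into
  -- `c`. So `t ^ m P ⊆ cR`, and `P` is isomorphic to `{r | c * r ∈ t ^ m P}`, which contains `t ^
  -- m` because `c ∈ P`.
  let m := e + j + j
  have hinj : ∀ z : R, z ≠ 0 → Function.Injective (LinearMap.mulLeft R z) := fun z hz ↦
    mul_right_injective₀ hz
  have hτ : τ ≠ 0 := fun h0 ↦ ht0 (congrArg Subtype.val h0)
  have hI : (Submodule.comap (LinearMap.mulLeft R c) (Submodule.map (LinearMap.mulLeft R (τ ^ m)) P)).FG := by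
    refine Ideal.fg_of_pow_mem hfg m _ ?_
    refine ⟨c, hcP, ?_⟩
    exact mul_comm _ _
  have h2 := Submodule.FG.map (LinearMap.mulLeft R c) hI
  have heq : Submodule.map (LinearMap.mulLeft R c)
      (Submodule.comap (LinearMap.mulLeft R c) (Submodule.map (LinearMap.mulLeft R (τ ^ m)) P)) =
      Submodule.map (LinearMap.mulLeft R (τ ^ m)) P := by
    rw [Submodule.map_comap_eq, inf_eq_right]
    rintro _ ⟨p, hp, rfl⟩
    obtain ⟨s, hs⟩ := Ideal.mem_span_singleton'.1 (Ideal.mem_comap.1 hp)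
    have hs' : (p : S) = q * s := by rw [mul_comm]; exact hs.symm
    have hsR : t ^ (e + j) * s ∈ R := by
      rw [h.mem_iff, h.map_pow_mul, pow_add, mul_smul]
      apply he
      have h1 : d (p : S) ∈ E₀ := (h.mem_iff _).1 p.2
      rw [hs', Derivation.leibniz] at h1
      have h3 : q • t ^ j • d s = t ^ j • (q • d s + s • d q) - s • t ^ j • d q := by
        rw [smul_add, smul_smul, smul_smul, smul_smul, smul_smul, mul_comm q, mul_comm s,
          add_sub_cancel_right]
      rw [h3]
      exact sub_mem (E₀.smul_mem _ h1) (E₀.smul_mem _ hj)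
    refine ⟨⟨_, hsR⟩, ?_⟩
    ext
    simp [c, m, τ, hs']
    ring
  rw [heq] at h2
  exact Submodule.fg_of_fg_map_injective _ (hinj _ (pow_ne_zero m hτ)) h2

end TwistData

/-! ### Comparison of spectra and localizations. -/

namespace TwistData

variable {S E : Type*} [CommRing S] [AddCommGroup E] [Module S E]
  {d : Derivation ℤ S E} {E₀ : Submodule S E} {t : S} {R : Subring S}
variable (h : TwistData d E₀ t R)

section
variable [IsLocalRing S]
  (hN : ∀ p ∈ IsLocalRing.maximalIdeal S, ∀ x ∈ E₀, ∃ y ∈ E₀, p • x = t • y)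
include h hN

/-- By integrality only the maximal ideal of `S` contracts to that of `R`, so some nonunit of `R`
avoids `Q`. -/
theorem exists_conductor {Q : Ideal S} [Q.IsPrime] (hQ : Q ≠ IsLocalRing.maximalIdeal S) :
    ∃ r ∈ R, r ∉ Q ∧ ∀ s : S, ∃ n : ℕ, r ^ n * s ∈ R := by
  have := h.isIntegral
  have := h.isLocalRing
  have hne : Q.comap (algebraMap R S) ≠ IsLocalRing.maximalIdeal R := by
    intro heq
    have : (Q.comap (algebraMap R S)).IsMaximal := heq ▸ inferInstance
    exact hQ (IsLocalRing.eq_maximalIdeal (Ideal.isMaximal_of_isIntegral_of_isMaximal_comap Q this))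
  have hlt := lt_of_le_of_ne (IsLocalRing.le_maximalIdeal (Ideal.IsPrime.ne_top inferInstance)) hne
  obtain ⟨r, hr, hrQ⟩ := SetLike.exists_of_lt hlt
  refine ⟨r, r.2, hrQ, h.exists_pow_mul_mem r.2 (hN _ ?_)⟩
  exact map_nonunit (algebraMap R S) r hr

theorem le_of_comap_le {Q Q' : Ideal S} [Q.IsPrime] [Q'.IsPrime]
    (hle : Q.comap (algebraMap R S) ≤ Q'.comap (algebraMap R S)) : Q ≤ Q' := by
  by_cases hQ' : Q' = IsLocalRing.maximalIdeal S
  · rw [hQ']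
    exact IsLocalRing.le_maximalIdeal (Ideal.IsPrime.ne_top inferInstance)
  · obtain ⟨r, hr, hrQ', hc⟩ := h.exists_conductor hN hQ'
    intro s hs
    obtain ⟨n, hn⟩ := hc s
    have h1 : (⟨r ^ n * s, hn⟩ : R) ∈ Q.comap (algebraMap R S) := Q.mul_mem_left _ hs
    exact ((Ideal.IsPrime.mem_or_mem ‹Q'.IsPrime› (hle h1)).resolve_left
      fun h2 ↦ hrQ' (Ideal.IsPrime.mem_of_pow_mem ‹_› n h2))

/-- Contraction is an isomorphism from the spectrum of `S` to that of `R`. -/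
noncomputable def specOrderIso : PrimeSpectrum S ≃o PrimeSpectrum R :=
  RelIso.ofSurjective
    (OrderEmbedding.ofMapLEIff (PrimeSpectrum.comap (algebraMap R S))
      fun _ _ ↦ ⟨fun hle ↦ h.le_of_comap_le hN hle, fun hle ↦ Ideal.comap_mono hle⟩)
    (by
      intro P
      have := h.isIntegral
      obtain ⟨Q, -, hQ, hQP⟩ := Ideal.exists_ideal_over_prime_of_isIntegral P.asIdeal (⊥ : Ideal S)
        (by
          intro x hx
          have : x = 0 := Subtype.ext hx
          rw [this]; exact zero_mem _)
      exact ⟨⟨Q, hQ⟩, PrimeSpectrum.ext hQP⟩)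

theorem ringKrullDim_eq : ringKrullDim R = ringKrullDim S :=
  (Order.krullDim_eq_of_orderIso (h.specOrderIso hN)).symm

theorem exists_prime_comap_eq (P : Ideal R) [hP : P.IsPrime] :
    ∃ Q : Ideal S, Q.IsPrime ∧ Q.comap (algebraMap R S) = P ∧ Q.height = P.height := by
  obtain ⟨Q, hQ⟩ := (h.specOrderIso hN).surjective ⟨P, hP⟩
  refine ⟨Q.asIdeal, Q.2, congrArg PrimeSpectrum.asIdeal hQ, ?_⟩
  have := Order.height_orderIso (h.specOrderIso hN) Q
  rw [hQ] at this
  rwa [← PrimeSpectrum.height_eq_orderHeight, ← PrimeSpectrum.height_eq_orderHeight, eq_comm] at this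

theorem localizationIn_comap_eq (F : Type*) [Field F] [Algebra S F] [FaithfulSMul S F]
    {Q : Ideal S} [Q.IsPrime] (hQ : Q ≠ IsLocalRing.maximalIdeal S) :
    localizationIn F (Q.comap (algebraMap R S)) = localizationIn F Q := by
  obtain ⟨r, hr, hrQ, hc⟩ := h.exists_conductor hN hQ
  ext x
  constructor
  · rintro ⟨a, b, hb, rfl⟩
    exact ⟨a, b, hb, rfl⟩
  · rintro ⟨a, b, hb, rfl⟩
    obtain ⟨m, hm⟩ := hc a
    obtain ⟨n, hn⟩ := hc b
    have hm' : r ^ (n + m) * a ∈ R := by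
      rw [pow_add, mul_assoc]; exact mul_mem (pow_mem hr n) hm
    have hn' : r ^ (n + m) * b ∈ R := by
      rw [add_comm, pow_add, mul_assoc]; exact mul_mem (pow_mem hr m) hn
    have hrn : r ^ (n + m) ∉ Q := fun h1 ↦ hrQ (Ideal.IsPrime.mem_of_pow_mem ‹_› _ h1)
    refine ⟨⟨_, hm'⟩, ⟨_, hn'⟩, fun h1 ↦ ?_, ?_⟩
    · exact (Ideal.IsPrime.mem_or_mem ‹Q.IsPrime› h1).elim hrn hb
    · change _ = algebraMap S F (r ^ (n + m) * a) / algebraMap S F (r ^ (n + m) * b)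
      rw [map_mul, map_mul, mul_div_mul_left]
      rw [Ne, FaithfulSMul.algebraMap_eq_zero_iff]
      rintro h0
      exact hrn (h0 ▸ zero_mem _)

end

end TwistData

/-! ### Noetherianity by Cohen's theorem. -/

/-- In a two-dimensional local factorial domain, nonmaximal nonzero primes are principal. -/
theorem Ideal.exists_eq_span_singleton_of_ringKrullDim_eq_two {S : Type*} [CommRing S] [IsDomain S]
    [IsLocalRing S] [UniqueFactorizationMonoid S] (hS : ringKrullDim S = 2)
    {Q : Ideal S} [Q.IsPrime] (h0 : Q ≠ ⊥) (hQ : Q ≠ IsLocalRing.maximalIdeal S) :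
    ∃ q : S, q ≠ 0 ∧ Q = Ideal.span {q} := by
  obtain ⟨q, hqQ, hq⟩ := Ideal.IsPrime.exists_mem_prime_of_ne_bot ‹Q.IsPrime› h0
  refine ⟨q, hq.ne_zero, ?_⟩
  -- Otherwise `0 < (q) < Q < N` is a chain too long for dimension two.
  by_contra hne
  have : (Ideal.span {q}).IsPrime := (Ideal.span_singleton_prime hq.ne_zero).2 hq
  have h1 : (⊥ : Ideal S) < Ideal.span {q} :=
    bot_lt_iff_ne_bot.2 (by simpa [Ideal.span_singleton_eq_bot] using hq.ne_zero)
  have h2 : Ideal.span {q} < Q :=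
    lt_of_le_of_ne ((Ideal.span_singleton_le_iff_mem Q).2 hqQ) (Ne.symm hne)
  have h3 : Q < IsLocalRing.maximalIdeal S :=
    lt_of_le_of_ne (IsLocalRing.le_maximalIdeal (Ideal.IsPrime.ne_top inferInstance)) hQ
  have e1 := Ideal.height_add_one_le_of_lt_of_isPrime h1
  have e2 := Ideal.height_add_one_le_of_lt_of_isPrime h2
  have e3 := Ideal.height_add_one_le_of_lt_of_isPrime h3
  have e4 : (IsLocalRing.maximalIdeal S).height = 2 := by
    have := IsLocalRing.maximalIdeal_height_eq_ringKrullDim (R := S)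
    rw [hS] at this
    exact WithBot.coe_injective this
  rw [e4] at e3
  have : (3 : ℕ∞) ≤ 2 :=
    calc (3 : ℕ∞) = 0 + 1 + 1 + 1 := by norm_num
      _ ≤ (⊥ : Ideal S).height + 1 + 1 + 1 := by gcongr; exact zero_le
      _ ≤ 2 := (add_le_add_left (add_le_add_left e1 1 |>.trans e2) 1).trans e3
  exact absurd this (by decide)

namespace TwistData

variable {S E : Type*} [CommRing S] [AddCommGroup E] [Module S E]
  {d : Derivation ℤ S E} {E₀ : Submodule S E} {t : S} {R : Subring S}

theorem isNoetherianRing (h : TwistData d E₀ t R) [IsDomain S] [IsLocalRing S] [IsNoetherianRing S]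
    [UniqueFactorizationMonoid S] (hS : ringKrullDim S = 2)
    (ht : t ∈ IsLocalRing.maximalIdeal S) (ht0 : t ≠ 0)
    (hq : ∀ q : S, q ≠ 0 → ∃ e : ℕ, ∀ x : E, q • x ∈ E₀ → t ^ e • x ∈ E₀)
    {M : Type*} [AddCommGroup M] [Module S M]
    [IsNoetherian S M] (htM : ∀ x : M, t • x = 0) (φ : E₀ →ₗ[S] M)
    (hφ : ∀ x, φ x = 0 → ∃ y ∈ E₀, (x : E) = t • y) : IsNoetherianRing R := by
  have hfg := h.fg_of_t_mem htM φ hφ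
  have := h.isIntegral
  refine IsNoetherianRing.of_prime_ne_bot fun P hP hP0 ↦ ?_
  by_cases htP : (⟨t, h.t_mem⟩ : R) ∈ P
  · exact hfg P htP
  obtain ⟨Q, -, hQ, rfl⟩ := Ideal.exists_ideal_over_prime_of_isIntegral P (⊥ : Ideal S) (by
    intro x hx
    have : x = 0 := Subtype.ext hx
    rw [this]; exact zero_mem _)
  obtain ⟨q, hq0, rfl⟩ := Ideal.exists_eq_span_singleton_of_ringKrullDim_eq_two hS (Q := Q)
    (by
      rintro rfl
      apply hP0
      rw [eq_bot_iff]
      intro x hx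
      exact Subtype.ext hx)
    (by rintro rfl; exact htP ht)
  exact h.fg_comap_span_singleton hfg ht0 (hq q hq0)

end TwistData

/-! ### Modules over the completion of `V`. -/

open IsLocalRing in
/-- Every element of the completion of `V` is congruent modulo `t` to an element of `S`, if `S` and
`V` have the same residue field and `t` generates the maximal ideal of `V`. -/
theorem AdicCompletion.exists_eq_algebraMap_add_mul {S V : Type*} [CommRing S] [IsLocalRing S]
    [CommRing V] [IsLocalRing V] [IsNoetherianRing V] [Algebra S V] [IsLocalHom (algebraMap S V)]
    (hres : Function.Surjective (ResidueField.map (algebraMap S V))) {t : V}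
    (htV : maximalIdeal V = Ideal.span {t}) (w : AdicCompletion (maximalIdeal V) V) :
    ∃ (s : S) (w' : AdicCompletion (maximalIdeal V) V),
      w = algebraMap V _ (algebraMap S V s) + algebraMap V _ t * w' := by
  -- Completion keeps the residue field, so the class of `w` lifts through `V` to `S`.
  obtain ⟨u, hu⟩ := (AdicCompletion.residueField_map_bijective V).2 (residue _ w)
  obtain ⟨u, rfl⟩ := hres u
  obtain ⟨s, rfl⟩ := residue_surjective u
  rw [ResidueField.map_residue, ResidueField.map_residue] at hu
  have h1 := Ideal.Quotient.eq.1 hu.symm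
  rw [AdicCompletion.maximalIdeal_eq_map] at h1
  have h2 : (maximalIdeal V).map (algebraMap V (AdicCompletion (maximalIdeal V) V)) =
      Ideal.span {algebraMap V (AdicCompletion (maximalIdeal V) V) t} :=
    (congrArg (Ideal.map _) htV).trans (by rw [Ideal.map_span, Set.image_singleton])
  rw [h2, Ideal.mem_span_singleton'] at h1
  obtain ⟨w', hw'⟩ := h1
  exact ⟨s, w', by rw [mul_comm, hw', add_sub_cancel]⟩

section Module

variable {S B L : Type*} [CommRing S] [CommRing B] [Algebra S B] [AddCommGroup L] [Module B L]
  [Module S L] [IsScalarTower S B L] {t : S}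

/-- Modulo `t`, each scalar of `B` acts as one of `S`, so generators over `B` still generate over
`S`. -/
theorem Module.finite_quotient_range_lsmul [Module.Finite B L]
    (hB : ∀ w : B, ∃ (s : S) (w' : B), w = algebraMap S B s + algebraMap S B t * w') :
    Module.Finite S (L ⧸ LinearMap.range (LinearMap.lsmul S L t)) := by
  classical
  set T := LinearMap.range (LinearMap.lsmul S L t)
  obtain ⟨σ, hσ⟩ := Module.Finite.fg_top (R := B) (M := L)
  refine ⟨σ.image T.mkQ, eq_top_iff.2 ?_⟩
  rintro x -
  obtain ⟨x, rfl⟩ := T.mkQ_surjective x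
  have hx : x ∈ Submodule.span B (σ : Set L) := hσ ▸ Submodule.mem_top
  induction hx using Submodule.span_induction with
  | mem x hx => exact Submodule.subset_span (by simpa using ⟨x, hx, rfl⟩)
  | zero => rw [map_zero]; exact zero_mem _
  | add x y _ _ hx hy => rw [map_add]; exact add_mem hx hy
  | smul w x _ hx =>
    obtain ⟨s, w', rfl⟩ := hB w
    have h1 : (algebraMap S B s + algebraMap S B t * w') • x = s • x + t • w' • x := by
      rw [add_smul, mul_smul, algebraMap_smul, algebraMap_smul]
    have h2 : T.mkQ (t • w' • x) = 0 := by
      rw [Submodule.mkQ_apply, Submodule.Quotient.mk_eq_zero]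
      exact ⟨w' • x, rfl⟩
    rw [h1, map_add, h2, add_zero, map_smul]
    exact Submodule.smul_mem _ _ hx

end Module

/-! ### The twisting derivation and the main theorem. -/

/-- The data of a twisted subring, with the module `K` inside an ambient module. -/
theorem Twists.twistData {S : Type*} [CommRing S] {t : S} {K : Type*} [AddCommGroup K] [Module S K]
    {R : Subring S}
    {D : Derivation ℤ (Localization (Submonoid.powers t))
      (LocalizedModule (Submonoid.powers t) K)}
    (hD : Twists (Submonoid.powers t) K R D) :
    TwistData (D.compAlgebraMap S)
      (LinearMap.range (LocalizedModule.mkLinearMap (Submonoid.powers t) K)) t R where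
  mem_iff := hD.mem_iff
  map_t := by
    have h := hD.map_smul t (Submonoid.mem_powers t) 1
    rw [D.map_one_eq_zero, smul_zero, ← Algebra.algebraMap_eq_smul_one] at h
    exact h
  smul_cancel x hx := by
    have h := IsLocalizedModule.map_units
      (LocalizedModule.mkLinearMap (Submonoid.powers t) K) ⟨t, Submonoid.mem_powers t⟩
    exact ((Module.End.isUnit_iff _).1 h).1 (by simpa using hx)
  exists_pow_smul_mem x := by
    obtain ⟨⟨k, ⟨_, n, rfl⟩⟩, hk⟩ := IsLocalizedModule.surj (Submonoid.powers t)
      (LocalizedModule.mkLinearMap (Submonoid.powers t) K) x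
    exact ⟨n, k, hk.symm⟩
  exists_eq_add n s := by
    obtain ⟨x, hx, b, hb⟩ := hD.ker_add (t ^ n) ⟨n, rfl⟩ s
    refine ⟨s - t ^ n * b, b, ?_, by ring⟩
    change D (algebraMap S _ (s - t ^ n * b)) = 0
    rw [map_sub, hb, add_sub_cancel_right, hx]

theorem IsTorsionFreeAlong.mem_of_pow_smul_mem {S L : Type*} [CommRing S] [AddCommGroup L]
    [Module S L] {t : S} {K : Submodule S L}
    (hK : IsTorsionFreeAlong (Submonoid.powers t) (L ⧸ K)) {n : ℕ} {y : L} (hy : t ^ n • y ∈ K) :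
    y ∈ K := by
  rw [← Submodule.Quotient.mk_eq_zero]
  apply hK (t ^ n) ⟨n, rfl⟩
  rwa [← Submodule.Quotient.mk_smul, Submodule.Quotient.mk_eq_zero]

theorem IsTorsionFreeAlong.mkLinearMap_injective {S K : Type*} [CommRing S] [AddCommGroup K]
    [Module S K] {C : Submonoid S} (hK : IsTorsionFreeAlong C K) :
    Function.Injective (LocalizedModule.mkLinearMap C K) := by
  rw [injective_iff_map_eq_zero]
  intro x hx
  obtain ⟨c, hc⟩ := (IsLocalizedModule.eq_zero_iff C (LocalizedModule.mkLinearMap C K)).1 hx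
  exact hK c c.2 x hc

/-- `F` is the common quotient field of `S ⊆ V`, and `V` dominates `S`. The finitely generated free
module `L` over the completion of `V` is the module called `K'` in the statement in words. -/
theorem theorem5p7
    {S V F : Type*}
    [CommRing S] [IsDomain S] [IsLocalRing S] [IsNoetherianRing S] [UniqueFactorizationMonoid S]
    (hS : ringKrullDim S = 2)
    [CommRing V] [IsDomain V] [IsDiscreteValuationRing V]
    [Field F] [Algebra S V] [Algebra V F] [Algebra S F] [IsScalarTower S V F]
    [IsFractionRing S F] [IsFractionRing V F] [IsLocalHom (algebraMap S V)]
    (hres : Function.Bijective (IsLocalRing.ResidueField.map (algebraMap S V)))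
    (t : S) (ht : t ∈ IsLocalRing.maximalIdeal S)
    (htV : IsLocalRing.maximalIdeal V = Ideal.span {algebraMap S V t})
    {L : Type*} [AddCommGroup L]
    [Module (AdicCompletion (IsLocalRing.maximalIdeal V) V) L]
    [Module.Free (AdicCompletion (IsLocalRing.maximalIdeal V) V) L]
    [Module.Finite (AdicCompletion (IsLocalRing.maximalIdeal V) V) L]
    [Module S L] [IsScalarTower S (AdicCompletion (IsLocalRing.maximalIdeal V) V) L]
    (K : Submodule S L)
    (hK : IsTorsionFreeAlong (Submonoid.powers t) (L ⧸ K))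
    (R : Subring S) (hR : IsTwistedBy (Submonoid.powers t) K R) :
    IsNoetherianRing R ∧ IsLocalRing R ∧ ringKrullDim R = 2 ∧
      ∀ (P : Ideal R) [P.IsPrime], P.height = 1 →
        ∃ (Q : Ideal S) (_ : Q.IsPrime), Q.height = 1 ∧
          localizationIn F P = localizationIn F Q := by
  have htm : ∀ a : S, algebraMap S (AdicCompletion (IsLocalRing.maximalIdeal V) V) a =
      algebraMap V _ (algebraMap S V a) := fun _ ↦ rfl
  have hSV : Function.Injective (algebraMap S V) := by
    have h := IsFractionRing.injective S F
    rw [IsScalarTower.algebraMap_eq S V F] at h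
    exact Function.Injective.of_comp h
  have htV0 : algebraMap S V t ≠ 0 := by
    intro h0
    rw [h0, Ideal.span_singleton_eq_bot.2 rfl] at htV
    exact IsDiscreteValuationRing.not_a_field V htV
  have ht0 : t ≠ 0 := by
    rintro rfl
    exact htV0 (map_zero _)
  have hmax : ∀ p ∈ IsLocalRing.maximalIdeal S, ∀ x : L, ∃ y : L, p • x = t • y := by
    intro p hp x
    have h := map_nonunit (algebraMap S V) p hp
    rw [htV, Ideal.mem_span_singleton'] at h
    obtain ⟨v, hv⟩ := h
    refine ⟨algebraMap V (AdicCompletion (IsLocalRing.maximalIdeal V) V) v • x, ?_⟩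
    rw [← algebraMap_smul (AdicCompletion (IsLocalRing.maximalIdeal V) V) p,
      ← algebraMap_smul (AdicCompletion (IsLocalRing.maximalIdeal V) V) t, smul_smul, htm, htm,
      ← map_mul, ← hv, mul_comm]
  have hpow : ∀ q : S, q ≠ 0 → ∃ (e : ℕ) (w : AdicCompletion (IsLocalRing.maximalIdeal V) V),
      algebraMap S _ (t ^ e) = w * algebraMap S _ q := by
    intro q hq
    have hirr : Irreducible (algebraMap S V t) :=
      (IsDiscreteValuationRing.irreducible_iff_uniformizer _).2 htV
    obtain ⟨e, u, hu⟩ := IsDiscreteValuationRing.eq_unit_mul_pow_irreducible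
      ((map_ne_zero_iff _ hSV).2 hq) hirr
    refine ⟨e, algebraMap V _ (u⁻¹ : Vˣ), ?_⟩
    rw [htm, htm, ← map_mul, hu, Units.inv_mul_cancel_left, map_pow]
  obtain ⟨D, hD⟩ := hR
  have h := hD.twistData
  set ι := LocalizedModule.mkLinearMap (Submonoid.powers t) K
  have hι : Function.Injective ι := hD.nonZeroDivisors_module.mkLinearMap_injective
  have hN : ∀ p ∈ IsLocalRing.maximalIdeal S, ∀ x ∈ LinearMap.range ι,
      ∃ y ∈ LinearMap.range ι, p • x = t • y := by
    rintro p hp _ ⟨k, rfl⟩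
    obtain ⟨y, hy⟩ := hmax p hp k
    have hyK : y ∈ K := hK.mem_of_pow_smul_mem (n := 1) (by
      rw [pow_one, ← hy]; exact K.smul_mem _ k.2)
    refine ⟨_, ⟨⟨y, hyK⟩, rfl⟩, ?_⟩
    rw [← map_smul, ← map_smul]
    exact congrArg ι (Subtype.ext hy)
  have hq : ∀ q : S, q ≠ 0 → ∃ e : ℕ, ∀ x : LocalizedModule (Submonoid.powers t) K,
      q • x ∈ LinearMap.range ι → t ^ e • x ∈ LinearMap.range ι := by
    intro q hq0
    obtain ⟨e, w, hw⟩ := hpow q hq0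
    refine ⟨e, ?_⟩
    rintro x ⟨k', hk'⟩
    obtain ⟨n, k, hk⟩ := h.exists_pow_smul_mem x
    have h1 : q • k = t ^ n • k' := by
      apply hι
      rw [map_smul, map_smul, hk, hk', smul_comm]
    have h2 : t ^ e • (k : L) = t ^ n • w • (k' : L) := by
      have h3 : q • (k : L) = t ^ n • (k' : L) := congrArg Subtype.val h1
      rw [← algebraMap_smul (AdicCompletion (IsLocalRing.maximalIdeal V) V) (t ^ e), hw, mul_smul,
        algebraMap_smul, h3, smul_algebra_smul_comm]
    -- `w` need not preserve `K`; saturation of `K` puts `w • k'` back in it.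
    have hwK : w • (k' : L) ∈ K := hK.mem_of_pow_smul_mem (n := n) (by
      rw [← h2]; exact K.smul_mem _ k.2)
    refine ⟨⟨_, hwK⟩, ?_⟩
    have h4 : t ^ n • ι ⟨_, hwK⟩ = t ^ n • t ^ e • x := by
      rw [smul_comm, ← hk, ← map_smul, ← map_smul]
      exact congrArg ι (Subtype.ext h2.symm)
    exact h.pow_smul_left_cancel h4
  set T := LinearMap.range (LinearMap.lsmul S L t)
  have : Module.Finite S (L ⧸ T) :=
    Module.finite_quotient_range_lsmul (B := AdicCompletion (IsLocalRing.maximalIdeal V) V)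
      (AdicCompletion.exists_eq_algebraMap_add_mul hres.2 htV)
  have hTt : ∀ x : L ⧸ T, t • x = 0 := by
    intro x
    obtain ⟨x, rfl⟩ := T.mkQ_surjective x
    rw [← map_smul, Submodule.mkQ_apply, Submodule.Quotient.mk_eq_zero]
    exact ⟨x, rfl⟩
  -- Saturation gives `K ∩ tL = tK`, so `E₀ / tE₀` embeds in `L / tL`.
  have hφ : ∀ x : LinearMap.range ι,
      ((T.mkQ.comp K.subtype).comp (LinearEquiv.ofInjective ι hι).symm.toLinearMap) x = 0 →
        ∃ y ∈ LinearMap.range ι, (x : LocalizedModule (Submonoid.powers t) K) = t • y := by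
    intro x hx
    obtain ⟨k, rfl⟩ := (LinearEquiv.ofInjective ι hι).surjective x
    simp only [LinearMap.comp_apply, LinearEquiv.coe_coe, LinearEquiv.symm_apply_apply,
      Submodule.mkQ_apply, Submodule.Quotient.mk_eq_zero] at hx
    obtain ⟨y, hy⟩ := hx
    have hy' : t • y = k := hy
    have hyK : y ∈ K := hK.mem_of_pow_smul_mem (n := 1) (by rw [pow_one, hy']; exact k.2)
    refine ⟨_, ⟨⟨y, hyK⟩, rfl⟩, ?_⟩
    rw [← map_smul]
    exact congrArg ι (Subtype.ext hy'.symm)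
  refine ⟨h.isNoetherianRing hS ht ht0 hq hTt _ hφ, h.isLocalRing,
    (h.ringKrullDim_eq hN).trans hS, fun P _ hP ↦ ?_⟩
  obtain ⟨Q, hQ, rfl, hQP⟩ := h.exists_prime_comap_eq hN P
  have : FaithfulSMul S F := (faithfulSMul_iff_algebraMap_injective S F).2
    (IsFractionRing.injective S F)
  refine ⟨Q, hQ, hQP.trans hP, h.localizationIn_comap_eq hN F ?_⟩
  rintro rfl
  have h1 := IsLocalRing.maximalIdeal_height_eq_ringKrullDim (R := S)
  rw [hQP, hP, hS] at h1
  exact absurd (WithBot.coe_injective (a₁ := (1 : ℕ∞)) (a₂ := 2) h1) (by decide)
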